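/- Let $X$ be a continuum, that is, a (nonempty) compact connected metric space. The following are equivalent: 1. $X$ is cyclicly connected: any two distinct points of $X$ lie on a circle in $X$, where a circle in $X$ is a subset of $X$ homeomorphic to the unit circle. 2. $X$ is $3$-strongly arc connected ($3$-sac): for any distinct points $x_1,x_2,x_3\in X$ there are an arc $\alpha:[0,1]\to X$ (a homeomorphism onto its image) and $t_1<t_2<t_3$ in $[0,1]$ with $\alpha(t_i)=x_i$ for $i=1,2,3$. 3. Any three distinct points of $X$ lie on a subset of $X$ that is a circle or a theta curve, where a theta curve is the union of three arcs with the same two distinct endpoints, any two of which meet exactly in these two endpoints. -/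

import Mathlib

namespace StrongArc

/-- `α : [0,1] → X` parametrizes an arc: it is a homeomorphism onto its image. -/
def IsArc {X : Type*} [TopologicalSpace X] (α : unitInterval → X) : Prop :=
  Topology.IsEmbedding α

/-- `X` is `n`-strongly arc connected (`n`-sac): for all distinct `x₁, …, xₙ` there is an arc
visiting them in this order. -/
def IsSac (n : ℕ) (X : Type*) [TopologicalSpace X] : Prop :=
  ∀ x : Fin n → X, Function.Injective x →
    ∃ α : unitInterval → X, IsArc α ∧
      ∃ t : Fin n → unitInterval, StrictMono t ∧ ∀ i, α (t i) = x i

/-- A subset of `X` is a circle (simple closed curve) if it is a homeomorphic copy of the unit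
circle. -/
def IsCircle {X : Type*} [TopologicalSpace X] (S : Set X) : Prop :=
  ∃ f : Circle → X, Topology.IsEmbedding f ∧ Set.range f = S

/-- A subset of `X` is a theta curve if it is the union of three arcs with the same two
(distinct) endpoints, any two of which have only these endpoints in common. -/
def IsThetaCurve {X : Type*} [TopologicalSpace X] (S : Set X) : Prop :=
  ∃ (p q : X) (α : Fin 3 → unitInterval → X),
    (∀ i, IsArc (α i) ∧ α i 0 = p ∧ α i 1 = q) ∧
    (∀ i j, i ≠ j → Set.range (α i) ∩ Set.range (α j) = {p, q}) ∧
    S = ⋃ i, Set.range (α i)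

/-- `X` is cyclicly connected: any two (distinct) points lie on a circle in `X`. -/
def IsCyclicallyConnected (X : Type*) [TopologicalSpace X] : Prop :=
  ∀ x y : X, x ≠ y → ∃ S : Set X, IsCircle S ∧ x ∈ S ∧ y ∈ S

end StrongArc

/-! Everything is surgery on arcs. An arc between two closed sets contains a bridge meeting each of
them in a single endpoint (`IsArcFrom.exists_bridge`), and a chord of a circle turns it into a theta
curve, hence yields new circles through a given point of the old one. Cyclic connectedness gives
arcs avoiding a prescribed point. Bridges cut from these arcs extend a circle through two points to
an arc or a theta curve catching the third. Conversely, two of the three arcs of a theta curve form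
a circle through any two given points. The hard implication is 3-sac to cyclicly connected. Follow
an arc from `x` through `y` to a third point, and take the supremum of the parameters up to `y`
whose points share a circle with `x`. Near that supremum the arc has a bypass, by which such a
circle can be pushed past it or up to `y` (`IsSac.exists_circle_beyond`); so `y` is reached. Arcs
live on arbitrary real intervals so that they glue without rescaling, and may be points because
bridges may degenerate. -/

namespace StrongArc

open Set Topology

variable {X : Type*} [TopologicalSpace X]

/-! ### Arcs: gluing, bridges, parametrizations -/

/-- `S` is an arc from `a` to `b`, where a single point counts as a degenerate arc. -/
def IsArcFrom (S : Set X) (a b : X) : Prop :=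
  ∃ (f : ℝ → X) (s t : ℝ), s ≤ t ∧ ContinuousOn f (Icc s t) ∧ InjOn f (Icc s t) ∧
    f s = a ∧ f t = b ∧ f '' Icc s t = S

theorem IsArcFrom.left_mem {S : Set X} {a b : X} (h : IsArcFrom S a b) : a ∈ S := by
  obtain ⟨f, s, t, hst, -, -, rfl, -, rfl⟩ := h
  exact mem_image_of_mem f (left_mem_Icc.2 hst)

theorem IsArcFrom.right_mem {S : Set X} {a b : X} (h : IsArcFrom S a b) : b ∈ S := by
  obtain ⟨f, s, t, hst, -, -, -, rfl, rfl⟩ := h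
  exact mem_image_of_mem f (right_mem_Icc.2 hst)

theorem IsArcFrom.symm {S : Set X} {a b : X} (h : IsArcFrom S a b) : IsArcFrom S b a := by
  obtain ⟨f, s, t, hst, hf, hi, rfl, rfl, rfl⟩ := h
  have hm : MapsTo (fun x : ℝ => -x) (Icc (-t) (-s)) (Icc s t) := by
    intro x hx
    constructor <;> linarith [hx.1, hx.2]
  refine ⟨fun x => f (-x), -t, -s, by linarith, hf.comp continuous_neg.continuousOn hm,
    hi.comp neg_injective.injOn hm, by simp, by simp, ?_⟩
  have : (fun x => f (-x)) '' Icc (-t) (-s) = f '' ((fun x : ℝ => -x) '' Icc (-t) (-s)) := by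
    rw [image_image]
  rw [this]
  simp

theorem isArcFrom_image {f : ℝ → X} {s t a b : ℝ} (hf : ContinuousOn f (Icc s t))
    (hi : InjOn f (Icc s t)) (hsa : s ≤ a) (hab : a ≤ b) (hbt : b ≤ t) :
    IsArcFrom (f '' Icc a b) (f a) (f b) :=
  ⟨f, a, b, hab, hf.mono (Icc_subset_Icc hsa hbt), hi.mono (Icc_subset_Icc hsa hbt), rfl, rfl, rfl⟩

/-- Change of parameter: the initial parameter of an arc can be chosen freely. -/
theorem IsArcFrom.exists_param {S : Set X} {a b : X} (h : IsArcFrom S a b) (s : ℝ) :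
    ∃ (f : ℝ → X) (t : ℝ), s ≤ t ∧ ContinuousOn f (Icc s t) ∧ InjOn f (Icc s t) ∧
      f s = a ∧ f t = b ∧ f '' Icc s t = S := by
  obtain ⟨f, s', t', hst, hf, hi, rfl, rfl, rfl⟩ := h
  have hm : MapsTo (fun x : ℝ => x + (s' - s)) (Icc s (t' - (s' - s))) (Icc s' t') := by
    intro x hx
    constructor <;> linarith [hx.1, hx.2]
  refine ⟨fun x => f (x + (s' - s)), t' - (s' - s), by linarith,
    hf.comp (by fun_prop) hm, hi.comp (add_left_injective _).injOn hm, by simp, by simp, ?_⟩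
  have : (fun x => f (x + (s' - s))) '' Icc s (t' - (s' - s)) =
      f '' ((fun x : ℝ => x + (s' - s)) '' Icc s (t' - (s' - s))) := by
    rw [image_image]
  rw [this, image_add_const_Icc]
  ring_nf

/-- Two arcs, the second starting where the first one ends, have a common parametrization. -/
theorem IsArcFrom.exists_param_pair {S₁ S₂ : Set X} {a b c : X} (h₁ : IsArcFrom S₁ a b)
    (h₂ : IsArcFrom S₂ b c) :
    ∃ (f : ℝ → X) (s t u : ℝ), s ≤ t ∧ t ≤ u ∧ ContinuousOn f (Icc s u) ∧
      InjOn f (Icc s t) ∧ InjOn f (Icc t u) ∧ f s = a ∧ f t = b ∧ f u = c ∧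
      f '' Icc s t = S₁ ∧ f '' Icc t u = S₂ := by
  obtain ⟨f, s, t, hst, hf, hi, hfs, hft, hfS⟩ := h₁
  obtain ⟨g, u, htu, hg, hgi, hgt, hgu, hgS⟩ := h₂.exists_param t
  set k : ℝ → X := fun x => if x ≤ t then f x else g x with hk
  have e₁ : EqOn k f (Icc s t) := fun x hx => if_pos hx.2
  have e₂ : EqOn k g (Icc t u) := by
    intro x hx
    rcases hx.1.eq_or_lt with rfl | hlt
    · simp [hk, hft, hgt]
    · exact if_neg hlt.not_ge
  refine ⟨k, s, t, u, hst, htu, ?_, hi.congr e₁.symm, hgi.congr e₂.symm, ?_, ?_, ?_, ?_, ?_⟩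
  · rw [← Icc_union_Icc_eq_Icc hst htu]
    exact (hf.congr e₁).union_of_isClosed (hg.congr e₂) isClosed_Icc isClosed_Icc
  · rw [e₁ (left_mem_Icc.2 hst), hfs]
  · rw [e₁ (right_mem_Icc.2 hst), hft]
  · rw [e₂ (right_mem_Icc.2 htu), hgu]
  · rw [e₁.image_eq, hfS]
  · rw [e₂.image_eq, hgS]

theorem IsArcFrom.trans {S₁ S₂ : Set X} {a b c : X} (h₁ : IsArcFrom S₁ a b)
    (h₂ : IsArcFrom S₂ b c) (h : S₁ ∩ S₂ ⊆ {b}) : IsArcFrom (S₁ ∪ S₂) a c := by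
  obtain ⟨f, s, t, u, hst, htu, hf, hi₁, hi₂, rfl, rfl, rfl, rfl, rfl⟩ := h₁.exists_param_pair h₂
  have key : ∀ x ∈ Icc s t, ∀ y ∈ Icc t u, f x = f y → x = y := by
    intro x hx y hy hxy
    have hx' : f x = f t := h ⟨mem_image_of_mem f hx, hxy ▸ mem_image_of_mem f hy⟩
    rw [hi₁ hx (right_mem_Icc.2 hst) hx', hi₂ hy (left_mem_Icc.2 htu) (hxy ▸ hx')]
  refine ⟨f, s, u, hst.trans htu, hf, ?_, rfl, rfl, ?_⟩
  · rw [← Icc_union_Icc_eq_Icc hst htu]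
    rintro x (hx | hx) y (hy | hy) hxy
    · exact hi₁ hx hy hxy
    · exact key x hx y hy hxy
    · exact (key y hy x hx hxy.symm).symm
    · exact hi₂ hx hy hxy
  · rw [← image_union, Icc_union_Icc_eq_Icc hst htu]

/-- An arc between two closed sets contains an arc meeting each of them in one endpoint only. -/
theorem IsArcFrom.exists_bridge {S K L : Set X} {a b : X} (h : IsArcFrom S a b)
    (hK : IsClosed K) (hL : IsClosed L) (ha : a ∈ K) (hb : b ∈ L) :
    ∃ (c d : X) (R : Set X), R ⊆ S ∧ IsArcFrom R c d ∧ R ∩ K = {c} ∧ R ∩ L = {d} := by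
  obtain ⟨f, s, t, hst, hf, hi, rfl, rfl, rfl⟩ := h
  have cL : IsCompact (Icc s t ∩ f ⁻¹' L) :=
    isCompact_Icc.of_isClosed_subset (hf.preimage_isClosed_of_isClosed isClosed_Icc hL)
      inter_subset_left
  -- `d` is the first parameter on `L`; below, `c` is the last parameter on `K` before it.
  obtain ⟨d, ⟨hd, hdL⟩, hdmin⟩ := cL.exists_isLeast ⟨t, right_mem_Icc.2 hst, hb⟩
  have hf' : ContinuousOn f (Icc s d) := hf.mono (Icc_subset_Icc_right hd.2)
  have cK : IsCompact (Icc s d ∩ f ⁻¹' K) :=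
    isCompact_Icc.of_isClosed_subset (hf'.preimage_isClosed_of_isClosed isClosed_Icc hK)
      inter_subset_left
  obtain ⟨c, ⟨hc, hcK⟩, hcmax⟩ := cK.exists_isGreatest ⟨s, left_mem_Icc.2 hd.1, ha⟩
  refine ⟨f c, f d, f '' Icc c d, image_mono (Icc_subset_Icc hc.1 hd.2),
    isArcFrom_image hf hi hc.1 hc.2 hd.2, ?_, ?_⟩
  · apply Subset.antisymm
    · rintro _ ⟨⟨r, hr, rfl⟩, hrK⟩
      have := hcmax ⟨⟨hc.1.trans hr.1, hr.2⟩, hrK⟩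
      rw [le_antisymm this hr.1, mem_singleton_iff]
    · rintro _ rfl
      exact ⟨mem_image_of_mem f (left_mem_Icc.2 hc.2), hcK⟩
  · apply Subset.antisymm
    · rintro _ ⟨⟨r, hr, rfl⟩, hrL⟩
      have := hdmin ⟨⟨hc.1.trans hr.1, hr.2.trans hd.2⟩, hrL⟩
      rw [le_antisymm hr.2 this, mem_singleton_iff]
    · rintro _ rfl
      exact ⟨mem_image_of_mem f (right_mem_Icc.2 hc.2), hdL⟩

/-- Nondegenerate arcs are parametrized by embeddings of the unit interval. -/
theorem IsArcFrom.exists_isArc [T2Space X] {S : Set X} {a b : X} (h : IsArcFrom S a b)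
    (hab : a ≠ b) : ∃ α : unitInterval → X, IsArc α ∧ α 0 = a ∧ α 1 = b ∧ range α = S := by
  obtain ⟨f, s, t, hst, hf, hi, rfl, rfl, rfl⟩ := h
  have hpos : 0 < t - s := sub_pos.2 (hst.lt_of_ne fun e => hab (congrArg f e))
  have hm : ∀ r : unitInterval, s + (r : ℝ) * (t - s) ∈ Icc s t := by
    intro r
    constructor
    · nlinarith [r.2.1]
    · nlinarith [r.2.2]
  have hcont : Continuous fun r : unitInterval => f (s + (r : ℝ) * (t - s)) :=
    hf.comp_continuous (by fun_prop) hm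
  refine ⟨fun r => f (s + (r : ℝ) * (t - s)), ?_, by simp, by simp, ?_⟩
  · refine (hcont.isClosedEmbedding ?_).isEmbedding
    intro x y hxy
    have := hi (hm x) (hm y) hxy
    exact Subtype.ext (mul_right_cancel₀ hpos.ne' (add_left_cancel this))
  · apply Subset.antisymm
    · rintro _ ⟨r, rfl⟩
      exact mem_image_of_mem f (hm r)
    · rintro _ ⟨x, hx, rfl⟩
      refine ⟨⟨(x - s) / (t - s), div_nonneg (by linarith [hx.1]) hpos.le,
        (div_le_one hpos).2 (by linarith [hx.2])⟩, ?_⟩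
      simp only
      rw [div_mul_cancel₀ _ hpos.ne', add_sub_cancel]

theorem IsArc.isArcFrom_image {α : unitInterval → X} (h : IsArc α) {s t : unitInterval}
    (hst : s ≤ t) : IsArcFrom (α '' Icc s t) (α s) (α t) := by
  have hm : ∀ x ∈ Icc (s : ℝ) t, x ∈ Icc (0 : ℝ) 1 := fun x hx =>
    ⟨s.2.1.trans hx.1, hx.2.trans t.2.2⟩
  refine ⟨IccExtend zero_le_one α, s, t, hst, h.continuous.Icc_extend'.continuousOn, ?_,
    IccExtend_val _ _ _, IccExtend_val _ _ _, ?_⟩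
  · intro x hx y hy hxy
    rw [IccExtend_of_mem _ _ (hm x hx), IccExtend_of_mem _ _ (hm y hy)] at hxy
    exact congrArg Subtype.val (h.injective hxy)
  · apply Subset.antisymm
    · rintro _ ⟨x, hx, rfl⟩
      rw [IccExtend_of_mem _ _ (hm x hx)]
      exact mem_image_of_mem α ⟨hx.1, hx.2⟩
    · rintro _ ⟨x, hx, rfl⟩
      exact ⟨x, ⟨hx.1, hx.2⟩, IccExtend_val _ _ _⟩

theorem IsArc.isArcFrom_range {α : unitInterval → X} (h : IsArc α) :
    IsArcFrom (range α) (α 0) (α 1) := by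
  have := h.isArcFrom_image (zero_le_one : (0 : unitInterval) ≤ 1)
  rwa [show Icc (0 : unitInterval) 1 = univ from
    eq_univ_of_forall fun x => ⟨x.2.1, x.2.2⟩, image_univ] at this

/-! ### Circles, their chords, and theta curves -/

/-- A closed curve that is injective up to its endpoints is a circle. -/
theorem isCircle_of_param [T2Space X] {f : ℝ → X} {s t : ℝ} (hst : s < t)
    (hf : ContinuousOn f (Icc s t)) (hi : InjOn f (Ico s t)) (h : f s = f t) :
    IsCircle (f '' Icc s t) := by
  have : Fact (0 < t - s) := ⟨sub_pos.2 hst⟩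
  have hp : s + (t - s) = t := by ring
  have hc : Continuous (AddCircle.liftIco (t - s) s f) :=
    AddCircle.liftIco_continuous (by rw [hp, h]) (by rwa [hp])
  have hinj : Function.Injective (AddCircle.liftIco (t - s) s f) := by
    intro x y hxy
    refine (AddCircle.equivIco (t - s) s).injective (Subtype.ext (hi ?_ ?_ hxy))
    · simpa only [hp] using (AddCircle.equivIco (t - s) s x).2
    · simpa only [hp] using (AddCircle.equivIco (t - s) s y).2
  let e := AddCircle.homeomorphCircle (T := t - s) (sub_pos.2 hst).ne'
  refine ⟨AddCircle.liftIco (t - s) s f ∘ e.symm,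
    (hc.isClosedEmbedding hinj).isEmbedding.comp e.symm.isEmbedding, ?_⟩
  rw [e.symm.surjective.range_comp]
  apply Subset.antisymm
  · rintro _ ⟨x, rfl⟩
    refine mem_image_of_mem f (Ico_subset_Icc_self ?_)
    simpa only [hp] using (AddCircle.equivIco (t - s) s x).2
  · have hIco : ∀ x ∈ Ico s t, f x ∈ range (AddCircle.liftIco (t - s) s f) := fun x hx =>
      ⟨(x : AddCircle (t - s)), AddCircle.liftIco_coe_apply (by rwa [hp])⟩
    rintro _ ⟨x, hx, rfl⟩
    rcases hx.2.eq_or_lt with rfl | hlt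
    · rw [← h]
      exact hIco s (left_mem_Ico.2 hst)
    · exact hIco x ⟨hx.1, hlt⟩

/-- Running along `S₁` and back along `S₂` is a closed curve; the only repetition is at the start
and the end. -/
theorem isCircle_union [T2Space X] {S₁ S₂ : Set X} {a b : X} (h₁ : IsArcFrom S₁ a b)
    (h₂ : IsArcFrom S₂ a b) (hab : a ≠ b) (h : S₁ ∩ S₂ = {a, b}) : IsCircle (S₁ ∪ S₂) := by
  obtain ⟨f, s, t, u, hst, htu, hf, hi₁, hi₂, rfl, rfl, hfu, rfl, rfl⟩ :=
    h₁.exists_param_pair h₂.symm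
  have hst' : s < t := hst.lt_of_ne fun e => hab (congrArg f e)
  rw [← image_union, Icc_union_Icc_eq_Icc hst htu]
  have key : ∀ x ∈ Icc s t, ∀ y ∈ Ico t u, f x = f y → x = y := by
    intro x hx y hy hxy
    have hx' : f x ∈ ({f s, f t} : Set X) :=
      h ▸ ⟨mem_image_of_mem f hx, hxy ▸ mem_image_of_mem f (Ico_subset_Icc_self hy)⟩
    rcases hx' with hx' | hx'
    · have := hi₂ (Ico_subset_Icc_self hy) (right_mem_Icc.2 htu) (by rw [← hxy, hx', hfu])
      exact absurd this hy.2.ne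
    · rw [hi₁ hx (right_mem_Icc.2 hst) hx',
        hi₂ (Ico_subset_Icc_self hy) (left_mem_Icc.2 htu) (hxy ▸ hx')]
  refine isCircle_of_param (hst'.trans_le htu) hf ?_ hfu.symm
  rintro x hx y hy hxy
  rcases le_total x t with hxt | hxt <;> rcases le_total y t with hyt | hyt
  · exact hi₁ ⟨hx.1, hxt⟩ ⟨hy.1, hyt⟩ hxy
  · exact key x ⟨hx.1, hxt⟩ y ⟨hyt, hy.2⟩ hxy
  · exact (key y ⟨hy.1, hyt⟩ x ⟨hxt, hx.2⟩ hxy.symm).symm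
  · exact hi₂ ⟨hxt, hx.2.le⟩ ⟨hyt, hy.2.le⟩ hxy

/-- Two points of a circle split it into two arcs. -/
theorem IsCircle.exists_split {C : Set X} (hC : IsCircle C) {a b : X} (ha : a ∈ C) (hb : b ∈ C)
    (hab : a ≠ b) : ∃ S₁ S₂ : Set X, IsArcFrom S₁ a b ∧ IsArcFrom S₂ a b ∧
      S₁ ∩ S₂ = {a, b} ∧ S₁ ∪ S₂ = C := by
  obtain ⟨g, hg, rfl⟩ := hC
  obtain ⟨a, rfl⟩ := ha
  obtain ⟨b, rfl⟩ := hb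
  have hpi := Real.two_pi_pos
  -- The circle is rotated so that `a` has parameter `0`; `hI` below gives injectivity on distances
  -- less than a full turn.
  set f : ℝ → X := fun x => g (a * Circle.exp x) with hfdef
  have hf : Continuous f := hg.continuous.comp (by fun_prop)
  have heq : ∀ {x y}, f x = f y → ∃ n : ℤ, x = y + n * (2 * Real.pi) := by
    intro x y hxy
    exact Circle.exp_eq_exp.1 (mul_left_cancel (hg.injective hxy))
  have hI : ∀ {x y}, f x = f y → |x - y| < 2 * Real.pi → x = y := by
    intro x y hxy h
    obtain ⟨n, hn⟩ := heq hxy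
    have h1 : |(n : ℝ)| < 1 := by
      have : x - y = n * (2 * Real.pi) := by rw [hn]; ring
      rw [this, abs_mul, abs_of_pos hpi] at h
      by_contra! hh
      nlinarith
    have : n = 0 := by
      rw [← Int.abs_lt_one_iff]
      exact_mod_cast h1
    rw [hn, this]
    simp
  have hf0 : f 0 = g a := by simp [hfdef]
  have hf2 : f (2 * Real.pi) = g a := by simp [hfdef]
  have hsurj : ∀ c : Circle, ∃ θ ∈ Ico (0 : ℝ) (2 * Real.pi), f θ = g c := by
    intro c
    obtain ⟨θ, hθ⟩ := Circle.exp_surjective (a⁻¹ * c)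
    refine ⟨toIcoMod hpi 0 θ, by simpa using toIcoMod_mem_Ico hpi 0 θ, ?_⟩
    have : Circle.exp (toIcoMod hpi 0 θ) = Circle.exp θ := by
      rw [Circle.exp_eq_exp]
      refine ⟨-toIcoDiv hpi 0 θ, ?_⟩
      rw [toIcoMod, zsmul_eq_mul]
      push_cast
      ring
    simp only [hfdef, this, hθ, mul_inv_cancel_left]
  obtain ⟨θ, hθ, hθb⟩ := hsurj b
  have hθ0 : 0 < θ := hθ.1.lt_of_ne fun e => hab (by rw [← hf0, ← hθb, e])
  have A₁ := isArcFrom_image (f := f) (s := 0) (t := θ) hf.continuousOn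
    (fun x hx y hy h => hI h (abs_lt.2 ⟨by linarith [hx.1, hy.2, hθ.2], by
      linarith [hx.2, hy.1, hθ.2]⟩)) le_rfl hθ.1 le_rfl
  have A₂ := isArcFrom_image (f := f) (s := θ) (t := 2 * Real.pi) hf.continuousOn
    (fun x hx y hy h => hI h (abs_lt.2 ⟨by linarith [hx.1, hy.2, hθ.2], by
      linarith [hx.2, hy.1, hθ.2]⟩)) le_rfl hθ.2.le le_rfl
  rw [hf0, hθb] at A₁
  rw [hθb, hf2] at A₂
  refine ⟨_, _, A₁, A₂.symm, ?_, ?_⟩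
  · apply Subset.antisymm
    · rintro _ ⟨⟨x, hx, rfl⟩, ⟨y, hy, hxy⟩⟩
      -- With `x ≤ θ ≤ y`, either both equal `θ`, or they are a full turn apart, so `x = 0`.
      by_cases h : |y - x| < 2 * Real.pi
      · have := hI hxy h
        subst this
        right
        rw [le_antisymm hx.2 hy.1, mem_singleton_iff, hθb]
      · left
        rw [abs_of_nonneg (by linarith [hx.2, hy.1])] at h
        have : x = 0 := by linarith [hx.1, hy.2]
        rw [this, hf0]
    · rintro _ (rfl | rfl)
      · exact ⟨A₁.left_mem, A₂.right_mem⟩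
      · exact ⟨A₁.right_mem, A₂.left_mem⟩
  · rw [← image_union, Icc_union_Icc_eq_Icc hθ.1 hθ.2.le]
    apply Subset.antisymm
    · rintro _ ⟨x, -, rfl⟩
      exact mem_range_self _
    · rintro _ ⟨c, rfl⟩
      obtain ⟨x, hx, hxc⟩ := hsurj c
      exact ⟨x, Ico_subset_Icc_self hx, hxc⟩

theorem IsCircle.isCompact {C : Set X} (hC : IsCircle C) : IsCompact C := by
  obtain ⟨f, hf, rfl⟩ := hC
  exact isCompact_range hf.continuous

theorem IsCircle.nontrivial {C : Set X} (hC : IsCircle C) : C.Nontrivial := by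
  obtain ⟨f, hf, rfl⟩ := hC
  refine ⟨f 1, mem_range_self _, f (-1), mem_range_self _, fun h => ?_⟩
  have := congrArg (fun z : Circle => (z : ℂ).re) (hf.injective h)
  norm_num at this

/-- Two points of a circle are joined within the circle by an arc through any third point. -/
theorem IsCircle.exists_arc_through {C : Set X} (hC : IsCircle C) {a b c : X} (ha : a ∈ C)
    (hb : b ∈ C) (hc : c ∈ C) (hab : a ≠ b) : ∃ S ⊆ C, IsArcFrom S a b ∧ c ∈ S := by
  obtain ⟨S₁, S₂, h₁, h₂, -, rfl⟩ := hC.exists_split ha hb hab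
  rcases hc with hc | hc
  · exact ⟨S₁, subset_union_left, h₁, hc⟩
  · exact ⟨S₂, subset_union_right, h₂, hc⟩

/-- Two points of a circle are joined within the circle by an arc avoiding any third point. -/
theorem IsCircle.exists_arc_avoiding {C : Set X} (hC : IsCircle C) {a b c : X} (ha : a ∈ C)
    (hb : b ∈ C) (hab : a ≠ b) (hca : c ≠ a) (hcb : c ≠ b) :
    ∃ S ⊆ C, IsArcFrom S a b ∧ c ∉ S := by
  obtain ⟨S₁, S₂, h₁, h₂, h, rfl⟩ := hC.exists_split ha hb hab
  by_cases hc : c ∈ S₁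
  · refine ⟨S₂, subset_union_right, h₂, fun hc' => ?_⟩
    have : c ∈ ({a, b} : Set X) := h ▸ ⟨hc, hc'⟩
    exact this.elim hca hcb
  · exact ⟨S₁, subset_union_left, h₁, hc⟩

/-- Adding a chord to a circle yields a theta curve. -/
theorem IsCircle.isThetaCurve_union [T2Space X] {C E : Set X} {a b : X} (hC : IsCircle C)
    (hE : IsArcFrom E a b) (hab : a ≠ b) (h : E ∩ C = {a, b}) : IsThetaCurve (C ∪ E) := by
  have ha : a ∈ C := (h.symm ▸ mem_insert a {b} : a ∈ E ∩ C).2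
  have hb : b ∈ C := (h.symm ▸ mem_insert_of_mem a rfl : b ∈ E ∩ C).2
  obtain ⟨S₁, S₂, h₁, h₂, h₁₂, rfl⟩ := hC.exists_split ha hb hab
  have hE' : ∀ S ⊆ S₁ ∪ S₂, IsArcFrom S a b → E ∩ S = {a, b} := by
    intro S hS hab'
    apply Subset.antisymm
    · exact h ▸ inter_subset_inter_right E hS
    · rintro _ (rfl | rfl)
      · exact ⟨hE.left_mem, hab'.left_mem⟩
      · exact ⟨hE.right_mem, hab'.right_mem⟩
  have e₁ := hE' S₁ subset_union_left h₁
  have e₂ := hE' S₂ subset_union_right h₂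
  obtain ⟨α₁, hα₁, ha₁, hb₁, rfl⟩ := h₁.exists_isArc hab
  obtain ⟨α₂, hα₂, ha₂, hb₂, rfl⟩ := h₂.exists_isArc hab
  obtain ⟨α₃, hα₃, ha₃, hb₃, rfl⟩ := hE.exists_isArc hab
  refine ⟨a, b, ![α₁, α₂, α₃], ?_, ?_, ?_⟩
  · intro i
    fin_cases i
    exacts [⟨hα₁, ha₁, hb₁⟩, ⟨hα₂, ha₂, hb₂⟩, ⟨hα₃, ha₃, hb₃⟩]
  · intro i j hij
    fin_cases i <;> fin_cases j <;> first | exact absurd rfl hij | skip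
    exacts [h₁₂, inter_comm _ _ ▸ e₁, inter_comm _ _ ▸ h₁₂, inter_comm _ _ ▸ e₂, e₁, e₂]
  · ext x
    simp [Fin.exists_fin_succ, or_assoc]

/-- A chord of a circle lies on a circle with any given point of the circle. -/
theorem IsCircle.exists_circle_of_chord [T2Space X] {C E : Set X} {a b x : X} (hC : IsCircle C)
    (hE : IsArcFrom E a b) (hab : a ≠ b) (h : E ∩ C = {a, b}) (hx : x ∈ C) :
    ∃ C', IsCircle C' ∧ x ∈ C' ∧ E ⊆ C' := by
  have ha : a ∈ C := (h.symm ▸ mem_insert a {b} : a ∈ E ∩ C).2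
  have hb : b ∈ C := (h.symm ▸ mem_insert_of_mem a rfl : b ∈ E ∩ C).2
  obtain ⟨S, hSC, hS, hxS⟩ := hC.exists_arc_through ha hb hx hab
  refine ⟨S ∪ E, isCircle_union hS hE hab ?_, Or.inl hxS, subset_union_right⟩
  apply Subset.antisymm
  · exact fun y hy => h ▸ ⟨hy.2, hSC hy.1⟩
  · rintro _ (rfl | rfl)
    · exact ⟨hS.left_mem, hE.left_mem⟩
    · exact ⟨hS.right_mem, hE.right_mem⟩

/-! ### Cyclic connectedness against 3-sac and theta curves -/

/-- An arc can be cut down to its outer two points, and any third point of an arc lies between its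
endpoints, so the order of the parameters needs no mention. -/
theorem isSac_three_iff [T2Space X] : IsSac 3 X ↔ ∀ x y z : X, x ≠ y → x ≠ z → y ≠ z →
    ∃ S, IsArcFrom S x z ∧ y ∈ S := by
  constructor
  · intro h x y z hxy hxz hyz
    obtain ⟨α, hα, t, ht, hti⟩ := h ![x, y, z] (by
      intro i j hij
      fin_cases i <;> fin_cases j <;> simp_all)
    have h0 : α (t 0) = x := hti 0
    have h1 : α (t 1) = y := hti 1
    have h2 : α (t 2) = z := hti 2
    have h01 : t 0 ≤ t 1 := ht.monotone (by decide)
    have h12 : t 1 ≤ t 2 := ht.monotone (by decide)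
    refine ⟨_, h0 ▸ h2 ▸ hα.isArcFrom_image (h01.trans h12), h1 ▸ mem_image_of_mem α ⟨h01, h12⟩⟩
  · intro h x hx
    obtain ⟨S, hS, h1⟩ := h (x 0) (x 1) (x 2) (hx.ne (by decide)) (hx.ne (by decide))
      (hx.ne (by decide))
    obtain ⟨α, hα, ha, hb, rfl⟩ := hS.exists_isArc (hx.ne (by decide))
    obtain ⟨r, hr⟩ := h1
    have hr0 : 0 < r := unitInterval.pos_iff_ne_zero.2 fun e =>
      hx.ne (by decide : (0 : Fin 3) ≠ 1) (by rw [← ha, ← hr, e])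
    have hr1 : r < 1 := unitInterval.lt_one_iff_ne_one.2 fun e =>
      hx.ne (by decide : (2 : Fin 3) ≠ 1) (by rw [← hb, ← hr, e])
    refine ⟨α, hα, ![0, r, 1], ?_, ?_⟩
    · rw [Fin.strictMono_iff_lt_succ]
      intro i
      fin_cases i
      exacts [hr0, hr1]
    · intro i
      fin_cases i
      exacts [ha, hr, hb]

theorem IsCyclicallyConnected.exists_arc_avoiding (h : IsCyclicallyConnected X) {x y z : X}
    (hxy : x ≠ y) (hzx : z ≠ x) (hzy : z ≠ y) : ∃ S, IsArcFrom S x y ∧ z ∉ S := by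
  obtain ⟨C, hC, hx, hy⟩ := h x y hxy
  obtain ⟨S, -, hS, hz⟩ := hC.exists_arc_avoiding hx hy hxy hzx hzy
  exact ⟨S, hS, hz⟩

/-- If `z` is off the circle through `x` and `y`, a bridge to `z` avoiding `x` leaves the circle at
some `p ≠ x`; the circle itself supplies an arc from `x` to `p` through `y`. -/
theorem IsCyclicallyConnected.isSac_three [T2Space X] (h : IsCyclicallyConnected X) :
    IsSac 3 X := by
  refine isSac_three_iff.2 fun x y z hxy hxz hyz => ?_
  obtain ⟨C, hC, hx, hy⟩ := h x y hxy
  by_cases hz : z ∈ C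
  · obtain ⟨S, -, hS, hyS⟩ := hC.exists_arc_through hx hz hy hxz
    exact ⟨S, hS, hyS⟩
  · obtain ⟨A, hA, hxA⟩ := h.exists_arc_avoiding hyz hxy hxz
    obtain ⟨p, q, R, hRA, hR, hRC, hRz⟩ :=
      hA.exists_bridge hC.isCompact.isClosed isClosed_singleton hy (mem_singleton z)
    have hq : q = z := (hRz.symm ▸ mem_singleton q : q ∈ R ∩ {z}).2
    subst hq
    have hp : p ∈ R ∩ C := hRC.symm ▸ mem_singleton p
    obtain ⟨S, hSC, hS, hyS⟩ := hC.exists_arc_through hx hp.2 hy fun e => hxA (hRA (e ▸ hp.1))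
    exact ⟨S ∪ R, hS.trans hR fun w hw => hRC ▸ ⟨hw.2, hSC hw.1⟩, Or.inl hyS⟩

theorem IsCyclicallyConnected.exists_circle_or_theta [T2Space X] (h : IsCyclicallyConnected X)
    {x y z : X} (hxy : x ≠ y) (hxz : x ≠ z) (hyz : y ≠ z) :
    ∃ S : Set X, (IsCircle S ∨ IsThetaCurve S) ∧ x ∈ S ∧ y ∈ S ∧ z ∈ S := by
  obtain ⟨C, hC, hx, hy⟩ := h x y hxy
  by_cases hz : z ∈ C
  · exact ⟨C, Or.inl hC, hx, hy, hz⟩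
  -- It is enough to find a chord of `C` through `z`. The two arcs of a circle through `x` and `z`
  -- give two bridges from `C` to `z`.
  suffices ∃ (E : Set X) (a b : X), IsArcFrom E a b ∧ a ≠ b ∧ E ∩ C = {a, b} ∧ z ∈ E by
    obtain ⟨E, a, b, hE, hab, hEC, hzE⟩ := this
    exact ⟨C ∪ E, Or.inr (hC.isThetaCurve_union hE hab hEC), Or.inl hx, Or.inl hy, Or.inr hzE⟩
  obtain ⟨D, hD, hxD, hzD⟩ := h x z hxz
  obtain ⟨D₁, D₂, hD₁, hD₂, hD₁₂, hDD⟩ := hD.exists_split hxD hzD hxz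
  have bridge : ∀ A, IsArcFrom A x z → ∃ p R, R ⊆ A ∧ IsArcFrom R p z ∧ R ∩ C = {p} := by
    intro A hA
    obtain ⟨p, q, R, hRA, hR, hRC, hRz⟩ :=
      hA.exists_bridge hC.isCompact.isClosed isClosed_singleton hx (mem_singleton z)
    have hq : q = z := (hRz.symm ▸ mem_singleton q : q ∈ R ∩ {z}).2
    exact ⟨p, R, hRA, hq ▸ hR, hRC⟩
  obtain ⟨p₁, R₁, hRD₁, hR₁, hRC₁⟩ := bridge D₁ hD₁
  obtain ⟨p₂, R₂, hRD₂, hR₂, hRC₂⟩ := bridge D₂ hD₂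
  have hp₁ : p₁ ∈ R₁ ∩ C := hRC₁.symm ▸ mem_singleton p₁
  have hp₂ : p₂ ∈ R₂ ∩ C := hRC₂.symm ▸ mem_singleton p₂
  have hRR : ∀ w ∈ R₁, w ∈ R₂ → w = x ∨ w = z := fun w h₁ h₂ => by
    have : w ∈ ({x, z} : Set X) := hD₁₂ ▸ ⟨hRD₁ h₁, hRD₂ h₂⟩
    simpa using this
  have hRx₁ : x ∈ R₁ → x = p₁ := fun h => by simpa using (hRC₁ ▸ ⟨h, hx⟩ : x ∈ ({p₁} : Set X))
  have hRx₂ : x ∈ R₂ → x = p₂ := fun h => by simpa using (hRC₂ ▸ ⟨h, hx⟩ : x ∈ ({p₂} : Set X))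
  by_cases hp : p₁ = p₂
  -- A common foot must be `x`, and the bridges form a circle touching `C` only there. A bridge
  -- between the two circles avoiding `x` then provides the second foot of the chord.
  · subst hp
    have hpx : p₁ = x := (hRR p₁ hp₁.1 hp₂.1).resolve_right fun e => hz (e ▸ hp₁.2)
    subst hpx
    have hD' : IsCircle (R₁ ∪ R₂) := isCircle_union hR₁ hR₂ hxz <| by
      apply Subset.antisymm
      · exact fun w hw => hRR w hw.1 hw.2
      · rintro _ (rfl | rfl)
        exacts [⟨hp₁.1, hp₂.1⟩, ⟨hR₁.right_mem, hR₂.right_mem⟩]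
    have hDC : (R₁ ∪ R₂) ∩ C = {p₁} := by rw [union_inter_distrib_right, hRC₁, hRC₂, union_self]
    have hzD' : z ∈ R₁ ∪ R₂ := Or.inl hR₁.right_mem
    obtain ⟨A, hA, hxA⟩ := h.exists_arc_avoiding hyz hxy hxz
    obtain ⟨c, d, R, hRA, hR, hRC, hRD⟩ :=
      hA.exists_bridge hC.isCompact.isClosed hD'.isCompact.isClosed hy hzD'
    have hc : c ∈ R ∩ C := hRC.symm ▸ mem_singleton c
    have hd : d ∈ R ∩ (R₁ ∪ R₂) := hRD.symm ▸ mem_singleton d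
    have hcx : c ≠ p₁ := fun e => hxA (hRA (e ▸ hc.1))
    have hdx : d ≠ p₁ := fun e => hxA (hRA (e ▸ hd.1))
    obtain ⟨S, hSD, hS, hzS⟩ := hD'.exists_arc_through hd.2 (Or.inl hp₁.1) hzD' hdx
    refine ⟨R ∪ S, c, p₁, hR.trans hS fun w hw => hRD ▸ ⟨hw.1, hSD hw.2⟩, hcx, ?_, Or.inr hzS⟩
    have hSC : S ∩ C = {p₁} := by
      apply Subset.antisymm
      · exact hDC ▸ inter_subset_inter_left C hSD
      · rintro _ rfl
        exact ⟨hS.right_mem, hx⟩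
    rw [union_inter_distrib_right, hRC, hSC, singleton_union]
  · refine ⟨R₁ ∪ R₂, p₁, p₂, hR₁.trans hR₂.symm ?_, hp, ?_, Or.inl hR₁.right_mem⟩
    · intro w hw
      refine (hRR w hw.1 hw.2).resolve_left ?_
      rintro rfl
      exact hp ((hRx₁ hw.1).symm.trans (hRx₂ hw.2))
    · rw [union_inter_distrib_right, hRC₁, hRC₂, singleton_union]

theorem IsThetaCurve.exists_circle [T2Space X] {S : Set X} (hS : IsThetaCurve S) {x y : X}
    (hx : x ∈ S) (hy : y ∈ S) : ∃ C, IsCircle C ∧ x ∈ C ∧ y ∈ C := by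
  obtain ⟨p, q, α, hα, hαα, rfl⟩ := hS
  obtain ⟨i, hi⟩ := mem_iUnion.1 hx
  obtain ⟨j, hj⟩ := mem_iUnion.1 hy
  have hA : ∀ k, IsArcFrom (range (α k)) p q := fun k =>
    (hα k).2.1 ▸ (hα k).2.2 ▸ (hα k).1.isArcFrom_range
  have hpq : p ≠ q := by
    rw [← (hα 0).2.1, ← (hα 0).2.2]
    exact (hα 0).1.injective.ne zero_ne_one
  have hC : ∀ k l, k ≠ l → IsCircle (range (α k) ∪ range (α l)) := fun k l hkl =>
    isCircle_union (hA k) (hA l) hpq (hαα k l hkl)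
  by_cases hij : i = j
  · subst hij
    obtain ⟨k, hk⟩ := exists_ne i
    exact ⟨_, hC i k hk.symm, Or.inl hi, Or.inl hj⟩
  · exact ⟨_, hC i j hij, Or.inl hi, Or.inr hj⟩

/-! ### From 3-sac to circles: bypassing and extending -/

/-- If an arc joins the endpoints of `f '' Icc s t` and avoids the interior point `f r`, it
contains an arc bypassing `f r`. -/
theorem exists_bypass [T2Space X] {f : ℝ → X} {s t r : ℝ} (hf : ContinuousOn f (Icc s t))
    (hsr : s ≤ r) (hrt : r ≤ t) {R : Set X} (hR : IsArcFrom R (f s) (f t)) (hr : f r ∉ R) :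
    ∃ a b B, s ≤ a ∧ a < r ∧ r < b ∧ b ≤ t ∧ IsArcFrom B (f a) (f b) ∧
      B ∩ f '' Icc s t = {f a, f b} := by
  have hK : IsClosed (f '' Icc s r) :=
    (isCompact_Icc.image_of_continuousOn (hf.mono (Icc_subset_Icc_right hrt))).isClosed
  have hL : IsClosed (f '' Icc r t) :=
    (isCompact_Icc.image_of_continuousOn (hf.mono (Icc_subset_Icc_left hsr))).isClosed
  -- The bridge joins the two halves of the arc; their common point `f r` is not on `R`, so neither
  -- foot is `f r`.
  obtain ⟨c, d, B, hBR, hB, hBK, hBL⟩ := hR.exists_bridge hK hL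
    (mem_image_of_mem f (left_mem_Icc.2 hsr)) (mem_image_of_mem f (right_mem_Icc.2 hrt))
  have hc : c ∈ B ∩ f '' Icc s r := hBK.symm ▸ mem_singleton c
  have hd : d ∈ B ∩ f '' Icc r t := hBL.symm ▸ mem_singleton d
  obtain ⟨hcB, a, ha, rfl⟩ := hc
  obtain ⟨hdB, b, hb, rfl⟩ := hd
  refine ⟨a, b, B, ha.1, ha.2.lt_of_ne ?_, hb.1.lt_of_ne ?_, hb.2, hB, ?_⟩
  · rintro rfl
    exact hr (hBR hcB)
  · rintro rfl
    exact hr (hBR hdB)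
  · rw [← Icc_union_Icc_eq_Icc hsr hrt, image_union, inter_union_distrib_left, hBK, hBL,
      singleton_union]

/-- Suppose that an arc `f` leaves a circle `C` at `f s`, and that its endpoint `f t` is joined to
another point of `C` by an arc `R` avoiding `f s`. Then any point of `C` lies on a circle
with a nondegenerate initial segment of `f` that ends on `R`. -/
theorem IsCircle.exists_extension [T2Space X] {C R : Set X} {f : ℝ → X} {s t : ℝ} {x c : X}
    (hC : IsCircle C) (hx : x ∈ C) (hst : s ≤ t) (hf : ContinuousOn f (Icc s t))
    (hi : InjOn f (Icc s t)) (hfC : f '' Icc s t ∩ C = {f s}) (hc : c ∈ C)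
    (hR : IsArcFrom R c (f t)) (hsR : f s ∉ R) :
    ∃ r ∈ Ioc s t, f r ∈ R ∧ ∃ C', IsCircle C' ∧ x ∈ C' ∧ f r ∈ C' := by
  obtain ⟨p, q, B, hBR, hB, hBC, hBA⟩ := hR.exists_bridge hC.isCompact.isClosed
    (isCompact_Icc.image_of_continuousOn hf).isClosed hc
    (mem_image_of_mem f (right_mem_Icc.2 hst))
  have hp : p ∈ B ∩ C := hBC.symm ▸ mem_singleton p
  have hq : q ∈ B ∩ f '' Icc s t := hBA.symm ▸ mem_singleton q
  obtain ⟨hqB, r, hr, rfl⟩ := hq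
  have hsr : s < r := hr.1.lt_of_ne (by rintro rfl; exact hsR (hBR hqB))
  have hps : p ≠ f s := by
    rintro rfl
    exact hsR (hBR hp.1)
  have hsub : f '' Icc s r ⊆ f '' Icc s t := image_mono (Icc_subset_Icc_right hr.2)
  -- The bridge followed by `f` back to `f s` is a chord of `C`.
  have hE : IsArcFrom (B ∪ f '' Icc s r) p (f s) :=
    hB.trans (isArcFrom_image hf hi le_rfl hr.1 hr.2).symm fun w hw => hBA ▸ ⟨hw.1, hsub hw.2⟩
  have hsC : f s ∈ f '' Icc s t ∩ C := hfC.symm ▸ mem_singleton (f s)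
  have hEC : (B ∪ f '' Icc s r) ∩ C = {p, f s} := by
    have : f '' Icc s r ∩ C = {f s} := by
      apply Subset.antisymm
      · exact hfC ▸ inter_subset_inter_left C hsub
      · rintro _ rfl
        exact ⟨mem_image_of_mem f (left_mem_Icc.2 hr.1), hsC.2⟩
    rw [union_inter_distrib_right, hBC, this, singleton_union]
  obtain ⟨C', hC', hxC', hEC'⟩ := hC.exists_circle_of_chord hE hps hEC hx
  exact ⟨r, ⟨hsr, hr.2⟩, hBR hqB, C', hC', hxC', hEC' (Or.inl hqB)⟩

/-- Points of a 3-sac space are not arc-separating. -/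
theorem IsSac.exists_arc_avoiding [T2Space X] (h : IsSac 3 X) {x y z : X} (hxy : x ≠ y)
    (hzx : z ≠ x) (hzy : z ≠ y) : ∃ S, IsArcFrom S x y ∧ z ∉ S := by
  -- The avoided point `z` is put last, and the arc is cut at `y`.
  obtain ⟨S, ⟨f, s, t, hst, hf, hi, rfl, rfl, rfl⟩, r, hr, rfl⟩ :=
    isSac_three_iff.1 h x y z hxy hzx.symm hzy.symm
  refine ⟨f '' Icc s r, isArcFrom_image hf hi le_rfl hr.1 hr.2, ?_⟩
  rintro ⟨w, hw, hwt⟩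
  have := hi ⟨hw.1, hw.2.trans hr.2⟩ (right_mem_Icc.2 hst) hwt
  subst this
  exact hzy (by rw [le_antisymm hw.2 hr.2])

/-- In a 3-sac space an interior point of an arc can be bypassed. -/
theorem IsSac.exists_bypass [T2Space X] (h : IsSac 3 X) {f : ℝ → X} {s t r : ℝ}
    (hf : ContinuousOn f (Icc s t)) (hi : InjOn f (Icc s t)) (hsr : s < r) (hrt : r < t) :
    ∃ a b B, s ≤ a ∧ a < r ∧ r < b ∧ b ≤ t ∧ IsArcFrom B (f a) (f b) ∧
      B ∩ f '' Icc s t = {f a, f b} := by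
  have hs : s ∈ Icc s t := left_mem_Icc.2 (hsr.trans hrt).le
  have ht : t ∈ Icc s t := right_mem_Icc.2 (hsr.trans hrt).le
  have hr : r ∈ Icc s t := ⟨hsr.le, hrt.le⟩
  obtain ⟨R, hR, hrR⟩ := h.exists_arc_avoiding (hi.ne hs ht (hsr.trans hrt).ne)
    (hi.ne hr hs hsr.ne') (hi.ne hr ht hrt.ne)
  exact StrongArc.exists_bypass hf hsr.le hrt.le hR hrR

/-- Every point of a 3-sac space with three points lies on a circle. -/
theorem IsSac.exists_circle [T2Space X] (h : IsSac 3 X) {x y z : X} (hxy : x ≠ y) (hxz : x ≠ z)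
    (hyz : y ≠ z) : ∃ C, IsCircle C ∧ x ∈ C := by
  -- With `x` in the middle of the arc, a bypass of `x` closes up to a circle through `x`.
  obtain ⟨S, ⟨f, s, t, hst, hf, hi, rfl, rfl, rfl⟩, r, hr, rfl⟩ :=
    isSac_three_iff.1 h y x z hxy.symm hyz hxz
  have hsr : s < r := hr.1.lt_of_ne (by rintro rfl; exact hxy rfl)
  have hrt : r < t := hr.2.lt_of_ne (by rintro rfl; exact hxz rfl)
  obtain ⟨a, b, B, ha, har, hrb, hb, hB, hBf⟩ := h.exists_bypass hf hi hsr hrt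
  have hab := har.trans hrb
  have hA := isArcFrom_image hf hi ha hab.le hb
  refine ⟨_, isCircle_union hB hA (hi.ne ⟨ha, hab.le.trans hb⟩ ⟨ha.trans hab.le, hb⟩ hab.ne) ?_,
    Or.inr (mem_image_of_mem f ⟨har.le, hrb.le⟩)⟩
  apply Subset.antisymm
  · exact hBf ▸ inter_subset_inter_right B (image_mono (Icc_subset_Icc ha hb))
  · rintro _ (rfl | rfl)
    exacts [⟨hB.left_mem, hA.left_mem⟩, ⟨hB.right_mem, hA.right_mem⟩]

/-- The last point of an arc on a closed set. -/
theorem exists_last_mem [T2Space X] {f : ℝ → X} {s t : ℝ} {C : Set X} (hC : IsClosed C)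
    (hf : ContinuousOn f (Icc s t)) (hst : s ≤ t) (hs : f s ∈ C) :
    ∃ r ∈ Icc s t, f r ∈ C ∧ f '' Icc r t ∩ C = {f r} := by
  have hc : IsCompact (Icc s t ∩ f ⁻¹' C) :=
    isCompact_Icc.of_isClosed_subset (hf.preimage_isClosed_of_isClosed isClosed_Icc hC)
      inter_subset_left
  obtain ⟨r, ⟨hr, hrC⟩, hmax⟩ := hc.exists_isGreatest ⟨s, left_mem_Icc.2 hst, hs⟩
  refine ⟨r, hr, hrC, Subset.antisymm ?_ ?_⟩
  · rintro _ ⟨⟨w, hw, rfl⟩, hwC⟩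
    have := hmax ⟨⟨hr.1.trans hw.1, hw.2⟩, hwC⟩
    rw [le_antisymm this hw.1, mem_singleton_iff]
  · rintro _ rfl
    exact ⟨mem_image_of_mem f (left_mem_Icc.2 hr.2), hrC⟩

/-- An arc in a 3-sac space whose points approach `f w` along circles through `f s` can be
followed beyond `f w`, or up to a prescribed point `f u`. -/
theorem IsSac.exists_circle_beyond [T2Space X] (h : IsSac 3 X) {f : ℝ → X} {s t u w : ℝ}
    (hf : ContinuousOn f (Icc s t)) (hi : InjOn f (Icc s t)) (hsw : s < w) (hwu : w ≤ u)
    (hut : u < t) (hw : ∀ a < w, ∃ r, a < r ∧ s < r ∧ r ≤ w ∧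
      ∃ C, IsCircle C ∧ f s ∈ C ∧ f r ∈ C) :
    ∃ r, s < r ∧ r ≤ u ∧ (w < r ∨ r = u) ∧ ∃ C, IsCircle C ∧ f s ∈ C ∧ f r ∈ C := by
  obtain ⟨a, b, B, ha, haw, hwb, hb, hB, hBf⟩ := h.exists_bypass hf hi hsw (hwu.trans_lt hut)
  obtain ⟨r, har, hsr, hrw, C, hC, hsC, hrC⟩ := hw a haw
  obtain ⟨q, hq, hqC, hqf⟩ := exists_last_mem hC.isCompact.isClosed
    (hf.mono (Icc_subset_Icc hsr.le hut.le)) (hrw.trans hwu) hrC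
  have haq : a < q := har.trans_le hq.1
  have hsq : s < q := hsr.trans_le hq.1
  by_cases hqu : q = u
  · exact ⟨q, hsq, hqu.le, Or.inr hqu, C, hC, hsC, hqC⟩
  by_cases hwq : w < q
  · exact ⟨q, hsq, hq.2, Or.inl hwq, C, hC, hsC, hqC⟩
  have hqu' : q < u := hq.2.lt_of_ne hqu
  have hqb : q < b := (not_lt.1 hwq).trans_lt hwb
  -- There remains `a < q ≤ w < b`, where the arc leaves `C` for good at `q`. The return path goes
  -- along `f` to `f a`, across `B`, and back from `f b` to `f m`. It meets the arc between `q` and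
  -- `m` only at `f m`, so the extended circle must contain `f m`.
  obtain ⟨m, hm⟩ : ∃ m, m = min b u := ⟨_, rfl⟩
  have hqm : q < m := hm ▸ lt_min hqb hqu'
  have hmb : m ≤ b := hm ▸ min_le_left b u
  have hmu : m ≤ u := hm ▸ min_le_right b u
  have hmt : m ≤ t := hmu.trans hut.le
  have mem_of : ∀ {k v v'}, s ≤ v → v' ≤ t → k ∈ Icc s t → f k ∈ f '' Icc v v' → k ∈ Icc v v' := by
    rintro k v v' hv hv' hk ⟨l, hl, hlk⟩
    rwa [← hi ⟨hv.trans hl.1, hl.2.trans hv'⟩ hk hlk]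
  have mem_B : ∀ {k}, k ∈ Icc s t → f k ∈ B → k = a ∨ k = b := by
    intro k hk hkB
    have : f k ∈ ({f a, f b} : Set X) := hBf ▸ ⟨hkB, mem_image_of_mem f hk⟩
    rcases this with e | e
    · exact Or.inl (hi hk ⟨ha, by linarith⟩ e)
    · exact Or.inr (hi hk ⟨by linarith, hb⟩ e)
  have hR₁ : IsArcFrom (f '' Icc s a ∪ B) (f s) (f b) := by
    refine (isArcFrom_image hf hi le_rfl ha (by linarith)).trans hB ?_
    rintro _ ⟨⟨k, hk, rfl⟩, hkB⟩
    rcases mem_B ⟨hk.1, by linarith [hk.2]⟩ hkB with rfl | rfl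
    · rfl
    · linarith [hk.2]
  have hR : IsArcFrom (f '' Icc s a ∪ B ∪ f '' Icc m b) (f s) (f m) := by
    refine hR₁.trans (isArcFrom_image hf hi (by linarith) hmb hb).symm ?_
    rintro _ ⟨hk', ⟨k, hk, rfl⟩⟩
    have hkI : k ∈ Icc s t := ⟨by linarith [hk.1], by linarith [hk.2]⟩
    rcases hk' with hk' | hk'
    · have := mem_of le_rfl (by linarith) hkI hk'
      linarith [this.2, hk.1]
    · rcases mem_B hkI hk' with rfl | rfl
      · linarith [hk.1]
      · rfl
  have mem_R : ∀ {k}, q ≤ k → k ≤ m → f k ∈ f '' Icc s a ∪ B ∪ f '' Icc m b → k = m := by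
    intro k hqk hkm hk
    have hkI : k ∈ Icc s t := ⟨by linarith, by linarith⟩
    rcases hk with (hk | hk) | hk
    · have := mem_of le_rfl (by linarith) hkI hk
      linarith [this.2]
    · rcases mem_B hkI hk with rfl | rfl
      · linarith
      · exact le_antisymm hkm hmb
    · exact le_antisymm hkm (mem_of (by linarith) hb hkI hk).1
  have hsub : Icc q m ⊆ Icc s t := Icc_subset_Icc hsq.le hmt
  obtain ⟨k, hk, hkR, C', hC', hsC', hkC'⟩ := hC.exists_extension hsC hqm.le (hf.mono hsub)
    (hi.mono hsub) (Subset.antisymm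
      (hqf ▸ inter_subset_inter_left C (image_mono (Icc_subset_Icc_right hmu)))
      (singleton_subset_iff.2 ⟨mem_image_of_mem f (left_mem_Icc.2 hqm.le), hqC⟩)) hsC hR
    fun hqR => hqm.ne (mem_R le_rfl hqm.le hqR)
  obtain rfl := mem_R hk.1.le hk.2 hkR
  refine ⟨k, by linarith, hmu, ?_, C', hC', hsC', hkC'⟩
  rcases min_choice b u with e | e
  · exact Or.inl (by rw [hm, e]; exact hwb)
  · exact Or.inr (hm.trans e)

theorem IsSac.isCyclicallyConnected [T2Space X] [Infinite X] (h : IsSac 3 X) :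
    IsCyclicallyConnected X := by
  intro x y hxy
  obtain ⟨z, hz⟩ := (toFinite {x, y}).infinite_compl.nonempty
  have hzx : z ≠ x := fun e => hz (Or.inl e)
  have hzy : z ≠ y := fun e => hz (Or.inr e)
  obtain ⟨C, hC, hxC⟩ := h.exists_circle hxy hzx.symm hzy.symm
  -- The arc continues past `y` to `z`, so that `y` too is an interior point and can be bypassed if
  -- the supremum is `u`.
  obtain ⟨S, ⟨f, s, t, hst, hf, hi, rfl, rfl, rfl⟩, u, hu, rfl⟩ :=
    isSac_three_iff.1 h x y z hxy hzx.symm hzy.symm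
  have hsu : s < u := hu.1.lt_of_ne (by rintro rfl; exact hxy rfl)
  have hut : u < t := hu.2.lt_of_ne (by rintro rfl; exact hzy rfl)
  set T : Set ℝ := {r | s < r ∧ r ≤ u ∧ ∃ C, IsCircle C ∧ f s ∈ C ∧ f r ∈ C} with hT
  have hne : T.Nonempty := by
    have hsub : Icc s u ⊆ Icc s t := Icc_subset_Icc_right hut.le
    obtain ⟨q, hq, hqC, hqf⟩ :=
      exists_last_mem hC.isCompact.isClosed (hf.mono hsub) hsu.le hxC
    rcases hq.1.eq_or_lt with rfl | hsq
    -- Here `C` meets the arc up to `y` only at `x`; an arc avoiding `x` from another point of `C`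
    -- to `y` gives a first extension.
    · obtain ⟨c, hc, hcs⟩ := hC.nontrivial.exists_ne (f s)
      have hcu : c ≠ f u := by
        rintro rfl
        have : f u ∈ ({f s} : Set X) :=
          hqf ▸ ⟨mem_image_of_mem f (right_mem_Icc.2 hsu.le), hc⟩
        exact hxy.symm this
      obtain ⟨R, hR, hsR⟩ := h.exists_arc_avoiding hcu hcs.symm hxy
      obtain ⟨r, hr, -, hrC⟩ := hC.exists_extension hxC hsu.le (hf.mono hsub) (hi.mono hsub) hqf
        hc hR hsR
      exact ⟨r, hr.1, hr.2, hrC⟩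
    · exact ⟨q, hsq, hq.2, C, hC, hxC, hqC⟩
  have hbdd : BddAbove T := ⟨u, fun r hr => hr.2.1⟩
  obtain ⟨r₀, hr₀⟩ := hne
  obtain ⟨r, hsr, hru, hr, hrC⟩ := h.exists_circle_beyond hf hi
    (hr₀.1.trans_le (le_csSup hbdd hr₀)) (csSup_le ⟨r₀, hr₀⟩ fun r hr => hr.2.1) hut
    fun a ha => by
      obtain ⟨r, hr, har⟩ := exists_lt_of_lt_csSup ⟨r₀, hr₀⟩ ha
      exact ⟨r, har, hr.1, le_csSup hbdd hr, hr.2.2⟩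
  rcases hr with hr | rfl
  · exact absurd (le_csSup hbdd ⟨hsr, hru, hrC⟩) hr.not_ge
  · exact hrC

end StrongArc

theorem mainTheorem6 (X : Type*) [MetricSpace X] [CompactSpace X] [ConnectedSpace X] :
    List.TFAE [
      StrongArc.IsCyclicallyConnected X,
      StrongArc.IsSac 3 X,
      ∀ x y z : X, x ≠ y → x ≠ z → y ≠ z →
        ∃ S : Set X, (StrongArc.IsCircle S ∨ StrongArc.IsThetaCurve S) ∧
          x ∈ S ∧ y ∈ S ∧ z ∈ S] := by
  -- Conditions 2 and 3 only speak of three points; the third one comes from connectedness.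
  have hinf : ∀ x y : X, x ≠ y → Infinite X := fun x y hxy =>
    Set.infinite_univ_iff.1 (isPreconnected_univ.infinite_of_nontrivial
      ⟨x, Set.mem_univ x, y, Set.mem_univ y, hxy⟩)
  tfae_have 1 → 2 := StrongArc.IsCyclicallyConnected.isSac_three
  tfae_have 2 → 1 := fun h x y hxy => by
    have := hinf x y hxy
    exact h.isCyclicallyConnected x y hxy
  tfae_have 1 → 3 := fun h x y z hxy hxz hyz => h.exists_circle_or_theta hxy hxz hyz
  tfae_have 3 → 1 := fun h x y hxy => by
    have := hinf x y hxy
    obtain ⟨z, hz⟩ := (Set.toFinite {x, y}).infinite_compl.nonempty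
    obtain ⟨S, hS | hS, hx, hy, -⟩ :=
      h x y z hxy (fun e => hz (Or.inl e.symm)) fun e => hz (Or.inr e.symm)
    · exact ⟨S, hS, hx, hy⟩
    · exact hS.exists_circle hx hy
  tfae_finish
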